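/- Let $G$ be a compact connected (real, smooth, finite-dimensional) Lie group with Lie algebra $\mathfrak g$ of dimension $n$, equipped with a bi-invariant Riemannian metric $\langle\cdot,\cdot\rangle$, and let $A_1,\dots,A_n$ be an orthonormal basis of $\mathfrak g$. For $\xi\in\mathfrak g^*$ let $X_\xi\in\mathfrak g$ be the vector with $\langle X_\xi,Y\rangle=\xi(Y)$ for all $Y\in\mathfrak g$, and put $\mathrm{ad}^*_Y\xi=\xi\circ\mathrm{ad}_Y$. Let $\eta\in\mathfrak g^*$ be arbitrary (the case $\eta=0$ included), let $\mathcal O_\eta=\{\eta\circ\mathrm{Ad}_x : x\in G\}\subset\mathfrak g^*$ be its coadjoint orbit, and define on $\mathcal O_\eta\times\mathfrak g\times\mathfrak g^*$ the functions $$l_1(\theta,Y,\xi)=\theta(Y)+\tfrac12\,\xi(X_\xi),\qquad l_{i+1}(\theta,Y,\xi)=(\theta+\mathrm{ad}^*_Y\xi)(A_i)=\theta(A_i)+\xi([Y,A_i]),\quad i=1,\dots,n .$$ Then the Hamiltonian $l_1$ is functionally independent of each invariant $l_{i+1}$ for which $A_i$ is not in the center of $\mathfrak g$ (so of all of them if $\mathfrak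 g$ has trivial center): there is an open dense subset $D$ of $\mathcal O_\eta\times\mathfrak g\times\mathfrak g^*$ such that $dl_1\wedge dl_{i+1}\neq0$ at every point of $D$, for every $i\in\{1,\dots,n\}$ such that $A_i$ is not central. -/

import Mathlib

open scoped Manifold ContDiff

noncomputable section

namespace RiemannianCubics

/-! ### Tangent spaces and differentials on embedded submanifolds -/

section Embedded

variable {V : Type*} [AddCommGroup V] [Module ℝ V] [TopologicalSpace V]
  [IsTopologicalAddGroup V] [ContinuousSMul ℝ V]

/-- The tangent space at `p` of an embedded submanifold `S` of a finite-dimensional real vector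
space `V`: the velocities at `p` of the curves of `V` that stay in `S`. For an embedded submanifold
these velocities already form a linear subspace, and the span adds nothing. -/
def tangentAt (S : Set V) (p : V) : Submodule ℝ V :=
  Submodule.span ℝ
    {v : V | ∃ c : ℝ → V, (∀ t, c t ∈ S) ∧ c 0 = p ∧ HasDerivAt c v 0}

/-- The differential at `p`, as a covector on the tangent space of `S`, of the restriction to `S`
of a smooth function `f` on the ambient vector space. -/
def dOn (S : Set V) (f : V → ℝ) (p : V) : Module.Dual ℝ (tangentAt S p) :=
  (fderiv ℝ f p).toLinearMap ∘ₗ (tangentAt S p).subtype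

/-- The wedge product of two covectors, `(α ∧ β) (u, v) = α u * β v - β u * α v`. -/
def wedge {W : Type*} [AddCommGroup W] [Module ℝ W] (α β : Module.Dual ℝ W) :
    W →ₗ[ℝ] W →ₗ[ℝ] ℝ :=
  α.smulRight β - β.smulRight α

end Embedded

variable {E : Type*} [NormedAddCommGroup E] [NormedSpace ℝ E]
  {H : Type*} [TopologicalSpace H] (I : ModelWithCorners ℝ E H)
  (G : Type*) [TopologicalSpace G] [ChartedSpace H G] [Group G]

/-- The dual `𝔤*` of the Lie algebra `𝔤` of the Lie group `G`. -/
abbrev CoLieAlgebra : Type _ := StrongDual ℝ (GroupLieAlgebra I G)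

/-- The ambient vector space `𝔤* × 𝔤 × 𝔤*`. -/
abbrev Ambient : Type _ := CoLieAlgebra I G × GroupLieAlgebra I G × CoLieAlgebra I G

variable {G}

/-- The adjoint representation of `G` on `𝔤`: `Ad x` is the derivative at the identity of the
conjugation `y ↦ x y x⁻¹`. -/
def Ad (x : G) : GroupLieAlgebra I G →L[ℝ] GroupLieAlgebra I G :=
  (mfderiv I I (fun y : G => x * y * x⁻¹) 1 : E →L[ℝ] E)

variable {I}

/-- The coadjoint orbit of `η`, the set of all `Ad*_x η = η ∘ Ad x`. -/
def coadjointOrbit (η : CoLieAlgebra I G) : Set (CoLieAlgebra I G) :=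
  Set.range fun x : G => η.comp (Ad I x)

/-- The reduced phase space `O_η × 𝔤 × 𝔤*`, a submanifold of `𝔤* × 𝔤 × 𝔤*`. -/
def phaseSpace (η : CoLieAlgebra I G) : Set (Ambient I G) :=
  coadjointOrbit η ×ˢ Set.univ

section Metric

variable [IsManifold I 1 G]

/-- A Riemannian metric on `G` is bi-invariant if all left and right translations are
isometries. -/
structure IsBiInvariant
    (ρ : Bundle.ContMDiffRiemannianMetric I ∞ E (TangentSpace I : G → Type _)) : Prop where
  left : ∀ (x y : G) (v w : TangentSpace I y),
    ρ.inner (x * y) (mfderiv I I (fun z : G => x * z) y v) (mfderiv I I (fun z : G => x * z) y w)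
      = ρ.inner y v w
  right : ∀ (x y : G) (v w : TangentSpace I y),
    ρ.inner (y * x) (mfderiv I I (fun z : G => z * x) y v) (mfderiv I I (fun z : G => z * x) y w)
      = ρ.inner y v w

variable (ρ : Bundle.ContMDiffRiemannianMetric I ∞ E (TangentSpace I : G → Type _))

/-- In finite dimensions, the inner product on `𝔤` represents every covector uniquely. -/
theorem existsUnique_riesz [FiniteDimensional ℝ E] (ξ : CoLieAlgebra I G) :
    ∃! X : GroupLieAlgebra I G, ∀ Y : GroupLieAlgebra I G, ρ.inner 1 X Y = ξ Y := by
  have : FiniteDimensional ℝ (GroupLieAlgebra I G) := inferInstanceAs (FiniteDimensional ℝ E)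
  let B : GroupLieAlgebra I G →ₗ[ℝ] Module.Dual ℝ (GroupLieAlgebra I G) :=
    { toFun := fun X => (ρ.inner 1 X).toLinearMap
      map_add' := fun X Y => by ext; simp
      map_smul' := fun c X => by ext; simp }
  have hB : Function.Injective B := by
    rw [← LinearMap.ker_eq_bot, LinearMap.ker_eq_bot']
    intro X hX
    by_contra h
    have h1 := ρ.pos 1 X h
    have h2 : ρ.inner 1 X X = 0 := LinearMap.congr_fun hX X
    exact h1.ne' h2
  have hs : Function.Surjective B :=
    (LinearMap.injective_iff_surjective_of_finrank_eq_finrank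
      (Subspace.dual_finrank_eq (K := ℝ) (V := GroupLieAlgebra I G)).symm).1 hB
  obtain ⟨X, hX⟩ := hs ξ.toLinearMap
  refine ⟨X, fun Y => LinearMap.congr_fun hX Y, fun X' hX' => hB ?_⟩
  rw [hX]
  exact LinearMap.ext hX'

/-- The vector `X_ξ ∈ 𝔤` identified with the covector `ξ` by the metric, `⟨X_ξ, Y⟩ = ξ Y`. -/
def riesz [FiniteDimensional ℝ E] (ξ : CoLieAlgebra I G) : GroupLieAlgebra I G :=
  (existsUnique_riesz ρ ξ).choose

/-- The reduced Hamiltonian `l₁ (θ, Y, ξ) = θ(Y) + ½ ξ(X_ξ)`. -/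
def hamiltonian [FiniteDimensional ℝ E] (w : Ambient I G) : ℝ :=
  w.1 w.2.1 + (1 / 2) * w.2.2 (riesz ρ w.2.2)

end Metric

/-- The invariant `(θ, Y, ξ) ↦ (θ + ad*_Y ξ)(A) = θ(A) + ξ([Y, A])` attached to `A ∈ 𝔤`. -/
def invariant (A : GroupLieAlgebra I G) (w : Ambient I G) : ℝ :=
  w.1 A + w.2.2 ⁅w.2.1, A⁆

end RiemannianCubics

end

namespace RiemannianCubics

/-! Only variations `(0, 0, δ)` of `ξ` are needed: they are tangent to the phase space whatever the
orbit looks like, and along them `dl₁` takes the value `δ (X_ξ)` and `dl_{i+1}` the value `δ [Y,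
A_i]`. Hence the wedge is nonzero wherever `X_ξ` and `[Y, A_i]` are linearly independent
(`wedge_dOn_ne_zero`). This condition is open. It is dense as soon as it holds for one pair `(Y,
ξ)`, because a `2 × 2` minor is a nonzero polynomial along lines in that direction
(`isOpen_dense_linearIndependent`). Such a pair exists when `A_i` is not central: some `[Z, A_i]` is
nonzero, and `X_ξ` can be chosen off its line. Finitely many open dense sets are then intersected.
-/

/-- A linearly independent pair is mapped to the standard basis of `ℝ²` by some linear map. -/
theorem exists_linearMap_pair {W : Type*} [AddCommGroup W] [Module ℝ W] {u v : W}
    (h : LinearIndependent ℝ ![u, v]) :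
    ∃ f : W →ₗ[ℝ] (Fin 2 → ℝ), f u = ![1, 0] ∧ f v = ![0, 1] := by
  obtain ⟨f, hf⟩ := (Fintype.linearCombination ℝ ![u, v]).exists_leftInverse_of_injective
    (LinearMap.ker_eq_bot.2 (linearIndependent_iff_injective_fintypeLinearCombination.1 h))
  refine ⟨f, ?_, ?_⟩
  · simpa [Fintype.linearCombination_apply] using LinearMap.congr_fun hf ![1, 0]
  · simpa [Fintype.linearCombination_apply] using LinearMap.congr_fun hf ![0, 1]

/-- Two linear maps that are linearly independent at one point are so on a dense set: a `2 × 2`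
minor is a nonzero polynomial along every line in the direction of that point. -/
theorem dense_setOf_linearIndependent_line {W : Type*} [AddCommGroup W] [Module ℝ W]
    {x y u v : W} (h : LinearIndependent ℝ ![u, v]) :
    Dense {t : ℝ | LinearIndependent ℝ ![x + t • u, y + t • v]} := by
  obtain ⟨f, hu, hv⟩ := exists_linearMap_pair h
  -- The determinant of `f (x + t • u)` and `f (y + t • v)` as a polynomial in `t`; it is monic of
  -- degree 2.
  let q : Polynomial ℝ :=
    (.X + .C (f x 0)) * (.X + .C (f y 1)) - .C (f x 1 * f y 0)
  have hq : q ≠ 0 := by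
    refine sub_ne_zero.2 fun h0 => ?_
    have := congrArg Polynomial.natDegree h0
    rw [Polynomial.natDegree_C, Polynomial.natDegree_mul (Polynomial.X_add_C_ne_zero _)
      (Polynomial.X_add_C_ne_zero _)] at this
    simp at this
  refine Dense.mono ?_ (q.roots.toFinset.finite_toSet.countable.dense_compl ℝ)
  intro t ht
  have ht' : q.eval t ≠ 0 := by
    simpa [hq] using ht
  rw [Set.mem_ofPred_eq, LinearIndependent.pair_iff]
  intro a b hab
  have e := congrArg f hab
  have e0 := congrFun e 0
  have e1 := congrFun e 1
  simp only [map_add, map_smul, map_zero, hu, hv, Pi.add_apply, Pi.smul_apply, Pi.zero_apply,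
    smul_eq_mul, Matrix.cons_val_zero, Matrix.cons_val_one] at e0 e1
  simp only [q, Polynomial.eval_sub, Polynomial.eval_mul, Polynomial.eval_add, Polynomial.eval_X,
    Polynomial.eval_C] at ht'
  constructor
  · refine (mul_eq_zero.1 (?_ : a * _ = 0)).resolve_right ht'
    -- Cramer's rule: each coefficient times the determinant vanishes.
    linear_combination (f y 1 + t) * e0 - f y 0 * e1
  · refine (mul_eq_zero.1 (?_ : b * _ = 0)).resolve_right ht'
    linear_combination (f x 0 + t) * e1 - f x 1 * e0

/-- The line through a point of `S × V` in the direction `(0, v)` stays in `S × V`. -/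
theorem zero_prod_mem_tangentAt {V₁ V₂ : Type*} [NormedAddCommGroup V₁] [NormedSpace ℝ V₁]
    [NormedAddCommGroup V₂] [NormedSpace ℝ V₂] {S : Set V₁} {p : V₁ × V₂} (hp : p.1 ∈ S) (v : V₂) :
    ((0, v) : V₁ × V₂) ∈ tangentAt (S ×ˢ Set.univ) p := by
  refine Submodule.subset_span ⟨fun t => p + t • (0, v), fun t => ?_, by simp, ?_⟩
  · simpa using hp
  · simpa using ((hasDerivAt_id (0 : ℝ)).smul_const ((0, v) : V₁ × V₂)).const_add p

section Bilinear

variable {E : Type*} [NormedAddCommGroup E] [NormedSpace ℝ E]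

/-- By the symmetry of `R`, the two terms of the product rule agree, which cancels the factor `1 /
2`. -/
theorem fderiv_pairing_add_quadratic (R : StrongDual ℝ E →L[ℝ] E)
    (w : StrongDual ℝ E × E × StrongDual ℝ E) (δ : StrongDual ℝ E)
    (hR : ∀ ξ ζ : StrongDual ℝ E, ξ (R ζ) = ζ (R ξ)) :
    fderiv ℝ (fun w : StrongDual ℝ E × E × StrongDual ℝ E =>
      w.1 w.2.1 + (1 / 2) * w.2.2 (R w.2.2)) w (0, 0, δ) = δ (R w.2.2) := by
  have h1 : HasFDerivAt (fun w : StrongDual ℝ E × E × StrongDual ℝ E => w.1)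
    (.fst ℝ _ _) w := hasFDerivAt_fst
  have h2 : HasFDerivAt (fun w : StrongDual ℝ E × E × StrongDual ℝ E => w.2.1)
    ((ContinuousLinearMap.fst ℝ _ _).comp (.snd ℝ _ _)) w :=
    hasFDerivAt_fst.comp w hasFDerivAt_snd
  have h3 : HasFDerivAt (fun w : StrongDual ℝ E × E × StrongDual ℝ E => w.2.2)
    ((ContinuousLinearMap.snd ℝ _ _).comp (.snd ℝ _ _)) w :=
    hasFDerivAt_snd.comp w hasFDerivAt_snd
  have h := (h1.clm_apply h2).add ((h3.clm_apply (R.hasFDerivAt.comp w h3)).const_mul (1 / 2 : ℝ))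
  erw [h.fderiv]
  simp [hR w.2.2 δ]
  ring

theorem fderiv_pairing_add_bilinear (B : E →L[ℝ] E) (A : E)
    (w : StrongDual ℝ E × E × StrongDual ℝ E) (δ : StrongDual ℝ E) :
    fderiv ℝ (fun w : StrongDual ℝ E × E × StrongDual ℝ E =>
      w.1 A + w.2.2 (B w.2.1)) w (0, 0, δ) = δ (B w.2.1) := by
  have h1 : HasFDerivAt (fun w : StrongDual ℝ E × E × StrongDual ℝ E => w.1)
    (.fst ℝ _ _) w := hasFDerivAt_fst
  have h2 : HasFDerivAt (fun w : StrongDual ℝ E × E × StrongDual ℝ E => w.2.1)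
    ((ContinuousLinearMap.fst ℝ _ _).comp (.snd ℝ _ _)) w :=
    hasFDerivAt_fst.comp w hasFDerivAt_snd
  have h3 : HasFDerivAt (fun w : StrongDual ℝ E × E × StrongDual ℝ E => w.2.2)
    ((ContinuousLinearMap.snd ℝ _ _).comp (.snd ℝ _ _)) w :=
    hasFDerivAt_snd.comp w hasFDerivAt_snd
  have h := (h1.clm_apply (hasFDerivAt_const A w)).add
    (h3.clm_apply (B.hasFDerivAt.comp w h2))
  erw [h.fderiv]
  simp

theorem wedge_dOn_ne_zero [FiniteDimensional ℝ E] (R : StrongDual ℝ E →L[ℝ] E)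
    (hR : ∀ ξ ζ : StrongDual ℝ E, ξ (R ζ) = ζ (R ξ)) (B : E →L[ℝ] E) (A : E)
    {S : Set (StrongDual ℝ E)} {w : StrongDual ℝ E × E × StrongDual ℝ E} (hw : w.1 ∈ S)
    (h : LinearIndependent ℝ ![R w.2.2, B w.2.1]) :
    wedge (W := tangentAt (S ×ˢ Set.univ) w)
      (dOn (S ×ˢ Set.univ) (fun w : StrongDual ℝ E × E × StrongDual ℝ E =>
        w.1 w.2.1 + (1 / 2) * w.2.2 (R w.2.2)) w)
      (dOn (S ×ˢ Set.univ) (fun w : StrongDual ℝ E × E × StrongDual ℝ E =>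
        w.1 A + w.2.2 (B w.2.1)) w) ≠ 0 := by
  have key : ∀ a : Fin 2 → ℝ, ∃ δ : StrongDual ℝ E, δ (R w.2.2) = a 0 ∧ δ (B w.2.1) = a 1 := by
    intro a
    obtain ⟨f, hu, hv⟩ := exists_linearMap_pair h
    exact ⟨LinearMap.toContinuousLinearMap
      (a 0 • (LinearMap.proj 0 ∘ₗ f) + a 1 • (LinearMap.proj 1 ∘ₗ f)), by simp [hu], by simp [hv]⟩
  -- On this dual pair `δ`, `ε` the wedge takes the value `1`.
  obtain ⟨δ, hδ0, hδ1⟩ := key ![1, 0]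
  obtain ⟨ε, hε0, hε1⟩ := key ![0, 1]
  intro h0
  have := LinearMap.congr_fun (LinearMap.congr_fun h0
    ⟨(0, 0, δ), zero_prod_mem_tangentAt hw (0, δ)⟩) ⟨(0, 0, ε), zero_prod_mem_tangentAt hw (0, ε)⟩
  simp only [wedge, dOn, LinearMap.sub_apply, LinearMap.smulRight_apply, LinearMap.comp_apply,
    Submodule.subtype_apply, ContinuousLinearMap.coe_coe, LinearMap.zero_apply,
    LinearMap.smul_apply, smul_eq_mul] at this
  rw [fderiv_pairing_add_quadratic R w _ hR, fderiv_pairing_add_quadratic R w _ hR,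
    fderiv_pairing_add_bilinear, fderiv_pairing_add_bilinear, hδ0, hδ1, hε0, hε1] at this
  simp at this

/-- Fibrewise over `S`, a pair of linear maps with one independent value is independent on an
open dense set. -/
theorem isOpen_dense_linearIndependent {V : Type*} [NormedAddCommGroup V] (S : Set V)
    (R : StrongDual ℝ E →L[ℝ] E) (B : E →L[ℝ] E) {Y : E} {ξ : StrongDual ℝ E}
    (h : LinearIndependent ℝ ![R ξ, B Y]) :
    let D := {w : (S ×ˢ Set.univ : Set (V × E × StrongDual ℝ E)) |
      LinearIndependent ℝ ![R w.1.2.2, B w.1.2.1]}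
    IsOpen D ∧ Dense D := by
  refine ⟨?_, fun w => ?_⟩
  · refine (isOpen_setOfPred_linearIndependent (𝕜 := ℝ) (E := E) (ι := Fin 2)).preimage
      (f := fun w : (S ×ˢ Set.univ : Set (V × E × StrongDual ℝ E)) =>
        ![R w.1.2.2, B w.1.2.1]) ?_
    fun_prop
  -- The line through `w` in the direction `(0, Y, ξ)` keeps the component in `S` fixed; good
  -- parameters accumulate at `t = 0`.
  · have hc : Continuous fun t : ℝ =>
        (⟨(w.1.1, w.1.2.1 + t • Y, w.1.2.2 + t • ξ), w.2.1, trivial⟩ :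
          (S ×ˢ Set.univ : Set (V × E × StrongDual ℝ E))) := by fun_prop
    have := map_mem_closure hc
      (dense_setOf_linearIndependent_line (x := R w.1.2.2) (y := B w.1.2.1) h 0)
      (t := {w | LinearIndependent ℝ ![R w.1.2.2, B w.1.2.1]}) fun t ht => by simpa using ht
    simpa using this

/-- The statement for an alternating bilinear bracket `L` on `E` and the isomorphism `R` of an
inner product. -/
theorem exists_isOpen_dense_wedge_ne_zero [FiniteDimensional ℝ E]
    (R : StrongDual ℝ E →L[ℝ] E)
    (hR : ∀ ξ ζ : StrongDual ℝ E, ξ (R ζ) = ζ (R ξ)) (hRs : Function.Surjective R)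
    (L : E →ₗ[ℝ] E →ₗ[ℝ] E) (hL : ∀ x, L x x = 0) {n : ℕ} (A : Fin n → E)
    (S : Set (StrongDual ℝ E)) :
    ∃ D : Set (S ×ˢ Set.univ : Set (StrongDual ℝ E × E × StrongDual ℝ E)), IsOpen D ∧ Dense D ∧
      ∀ w ∈ D, ∀ i, (∃ Z, L (A i) Z ≠ 0) →
      wedge (W := tangentAt (S ×ˢ Set.univ) (w : StrongDual ℝ E × E × StrongDual ℝ E))
      (dOn (S ×ˢ Set.univ) (fun w : StrongDual ℝ E × E × StrongDual ℝ E =>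
        w.1 w.2.1 + (1 / 2) * w.2.2 (R w.2.2)) w)
      (dOn (S ×ˢ Set.univ) (fun w : StrongDual ℝ E × E × StrongDual ℝ E =>
        w.1 (A i) + w.2.2 (L w.2.1 (A i))) w) ≠ 0 := by
  let B : Fin n → E →L[ℝ] E := fun i => LinearMap.toContinuousLinearMap (L.flip (A i))
  let D : {i // ∃ Z, L (A i) Z ≠ 0} →
      Set (S ×ˢ Set.univ : Set (StrongDual ℝ E × E × StrongDual ℝ E)) := fun i =>
    {w | LinearIndependent ℝ ![R w.1.2.2, B i w.1.2.1]}
  have hD : ∀ i, IsOpen (D i) ∧ Dense (D i) := by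
    rintro ⟨i, Z, hZ⟩
    have hZ' : B i Z ≠ 0 := fun h => hZ <| by
      rw [← LinearMap.IsAlt.neg hL]; simpa [B] using h
    -- Otherwise `E` would be a single line, on which an alternating bracket vanishes.
    obtain ⟨X, hX⟩ : ∃ X, ∀ a : ℝ, a • B i Z ≠ X := by
      by_contra! hX
      obtain ⟨a, ha⟩ := hX (A i)
      obtain ⟨b, hb⟩ := hX Z
      apply hZ
      calc L (A i) Z = L (a • B i Z) (b • B i Z) := by rw [ha, hb]
        _ = 0 := by rw [map_smul, LinearMap.map_smul₂, hL, smul_zero, smul_zero]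
    obtain ⟨ξ, rfl⟩ := hRs X
    exact isOpen_dense_linearIndependent S R (B i) (Y := Z) (ξ := ξ)
      (LinearIndependent.pair_symm_iff.1 ((LinearIndependent.pair_iff' hZ').2 hX))
  refine ⟨⋂ i, D i, isOpen_iInter_of_finite fun i => (hD i).1, ?_, fun w hw i hi => ?_⟩
  · rw [← Set.sInter_range]
    refine (Set.finite_range D).dense_sInter ?_ ?_ <;> rintro _ ⟨i, rfl⟩
    exacts [(hD i).1, (hD i).2]
  · exact wedge_dOn_ne_zero R hR (B i) (A i) w.2.1 (Set.mem_iInter.1 hw ⟨i, hi⟩)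

end Bilinear

section Metric

variable {E : Type*} [NormedAddCommGroup E] [NormedSpace ℝ E] [FiniteDimensional ℝ E]
  {H : Type*} [TopologicalSpace H] {I : ModelWithCorners ℝ E H}
  {G : Type*} [TopologicalSpace G] [ChartedSpace H G] [Group G] [IsManifold I 1 G]
  (ρ : Bundle.ContMDiffRiemannianMetric I ∞ E (TangentSpace I : G → Type _))

theorem inner_riesz (ξ : CoLieAlgebra I G) (Y : GroupLieAlgebra I G) :
    ρ.inner 1 (riesz ρ ξ) Y = ξ Y :=
  (existsUnique_riesz ρ ξ).choose_spec.1 Y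

theorem riesz_inner (X : GroupLieAlgebra I G) : riesz ρ (ρ.inner 1 X) = X :=
  (existsUnique_riesz ρ _).unique (inner_riesz ρ _) fun _ => rfl

theorem apply_riesz_comm (ξ ζ : CoLieAlgebra I G) : ξ (riesz ρ ζ) = ζ (riesz ρ ξ) := by
  rw [← inner_riesz ρ ξ, ← inner_riesz ρ ζ, ρ.symm]

/-- `ξ ↦ X_ξ` as a linear map. -/
noncomputable def rieszLinear : CoLieAlgebra I G →ₗ[ℝ] GroupLieAlgebra I G where
  toFun := riesz ρ
  map_add' ξ ζ := (existsUnique_riesz ρ (ξ + ζ)).unique (inner_riesz ρ _) fun Y => by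
    simp [inner_riesz]
  map_smul' c ξ := (existsUnique_riesz ρ (c • ξ)).unique (inner_riesz ρ _) fun Y => by
    simp [inner_riesz]

end Metric

/-- The Lie bracket of `𝔤` as a bilinear map. -/
noncomputable def bracketLinear {E : Type*} [NormedAddCommGroup E] [NormedSpace ℝ E] [CompleteSpace E]
    {H : Type*} [TopologicalSpace H] (I : ModelWithCorners ℝ E H)
    (G : Type*) [TopologicalSpace G] [ChartedSpace H G] [Group G]
    [LieGroup I (minSmoothness ℝ 3) G] :
    GroupLieAlgebra I G →ₗ[ℝ] GroupLieAlgebra I G →ₗ[ℝ] GroupLieAlgebra I G :=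
  LinearMap.mk₂ ℝ (fun X Y => ⁅X, Y⁆) add_lie smul_lie lie_add lie_smul

end RiemannianCubics

theorem mainTheorem5
    {E : Type*} [NormedAddCommGroup E] [NormedSpace ℝ E] [FiniteDimensional ℝ E]
    {H : Type*} [TopologicalSpace H] {I : ModelWithCorners ℝ E H}
    {G : Type*} [TopologicalSpace G] [ChartedSpace H G] [Group G]
    [LieGroup I ∞ G] [BoundarylessManifold I G]
    [T2Space G] [CompactSpace G] [ConnectedSpace G]
    (ρ : Bundle.ContMDiffRiemannianMetric I ∞ E (TangentSpace I : G → Type _))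
    (hρ : RiemannianCubics.IsBiInvariant ρ)
    {n : ℕ} (A : Module.Basis (Fin n) ℝ (GroupLieAlgebra I G))
    (hA : ∀ i j, ρ.inner 1 (A i) (A j) = if i = j then 1 else 0)
    (η : RiemannianCubics.CoLieAlgebra I G) :
    ∃ D : Set (RiemannianCubics.phaseSpace η), IsOpen D ∧ Dense D ∧
      ∀ w ∈ D, ∀ i : Fin n, (∃ Z : GroupLieAlgebra I G, ⁅A i, Z⁆ ≠ 0) →
        RiemannianCubics.wedge
          (RiemannianCubics.dOn (RiemannianCubics.phaseSpace η)
            (RiemannianCubics.hamiltonian ρ) w)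
          (RiemannianCubics.dOn (RiemannianCubics.phaseSpace η)
            (RiemannianCubics.invariant (A i)) w) ≠ 0 := by
  have : LieGroup I (minSmoothness ℝ 3) G := LieGroup.of_le (n := ∞) (by
    rw [minSmoothness_of_isRCLikeNormedField]; exact WithTop.coe_le_coe.2 le_top)
  have : CompleteSpace E := FiniteDimensional.complete ℝ E
  -- `GroupLieAlgebra I G` unfolds to `E`, so the statement over `E` applies by definitional
  -- unfolding.
  let R : StrongDual ℝ E →ₗ[ℝ] E := RiemannianCubics.rieszLinear ρ
  exact RiemannianCubics.exists_isOpen_dense_wedge_ne_zero (E := E)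
    (LinearMap.toContinuousLinearMap R)
    (RiemannianCubics.apply_riesz_comm ρ) (fun X => ⟨ρ.inner 1 X, RiemannianCubics.riesz_inner ρ X⟩)
    (RiemannianCubics.bracketLinear I G) (lie_self (L := GroupLieAlgebra I G)) A
    (RiemannianCubics.coadjointOrbit η)
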